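/- Let $q\ge 2$, and let $M,K\in\mathbb R^{n\times n}$ be symmetric positive definite. For $i,j\in\{1,\dots,q\}$ let $D_{ij},R_{ij}\in\mathbb R^{n\times n}$ be symmetric positive semidefinite matrices with $D_{ij}=D_{ji}$, $R_{ij}=R_{ji}$, $D_{ii}=R_{ii}=0$. Assume that the eigenvalues $\sigma_1,\dots,\sigma_n$ of $P:=M^{-1/2}KM^{-1/2}$ are distinct, and let $v_1,\dots,v_n\in\mathbb R^n$ be corresponding unit eigenvectors. Let $L_{\rm d}\in\mathbb R^{qn\times qn}$ be the matrix-weighted Laplacian with weights $W_{ij}=M^{-1/2}D_{ij}M^{-1/2}$, i.e. the $q\times q$ block matrix whose $i$-th diagonal block is $\sum_j W_{ij}$ and whose $(i,j)$ block is $-W_{ij}$ for $i\ne j$. For $k=1,\dots,n$ put $$G_{kk}=[I_q\otimes v_k^T]\,L_{\rm d}\,[I_q\otimes v_k]\in\mathbb R^{q\times q},$$ which is a real symmetric matrix, and let $\lambda_2(G_{kk})$ be its second smallest eigenvalue, counted with multiplicity. Suppose $\lambda_2(G_{kk})>0$ for all $k=1,\dots,n$. Then there exists $r>0$ such that for every $\varepsilon\in(0,r)$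 the array $$M\ddot x_i+Kx_i+\sum_{j=1}^q D_{ij}(\dot x_i-\dot x_j)+\varepsilon\sum_{j=1}^q R_{ij}(x_i-x_j)=0,\qquad i=1,\dots,q,$$ synchronizes, i.e. every solution satisfies $\|x_i(t)-x_j(t)\|\to0$ as $t\to\infty$ for all $i,j$. -/

import Mathlib

open scoped MatrixOrder Matrix Kronecker

/-- The weights of a matrix-weighted Laplacian: `W i j` is symmetric positive semidefinite,
`W i j = W j i`, and `W i i = 0`. -/
structure IsWeight {q n : ℕ} (W : Fin q → Fin q → Matrix (Fin n) (Fin n) ℝ) : Prop where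
  posSemidef : ∀ i j, (W i j).PosSemidef
  symm : ∀ i j, W i j = W j i
  diag : ∀ i, W i i = 0

/-- The matrix-weighted Laplacian `lap (W i j)`, a `q × q` block matrix with `n × n` blocks:
the `i`-th diagonal block is `∑ j, W i j`, and the off-diagonal block `(i, j)` is `- W i j`. -/
def lap {q n : ℕ} (W : Fin q → Fin q → Matrix (Fin n) (Fin n) ℝ) :
    Matrix (Fin q × Fin n) (Fin q × Fin n) ℝ :=
  Matrix.of fun x y =>
    if x.1 = y.1 then (∑ l, W x.1 l) x.2 y.2 else -(W x.1 y.1 x.2 y.2)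

/-- `x` (with `x i` the trajectory of the `i`-th oscillator) is a solution of
`M xᵢ'' + K xᵢ + ∑ⱼ Dᵢⱼ (xᵢ' - xⱼ') + ∑ⱼ Rᵢⱼ (xᵢ - xⱼ) = 0`, `i = 1, …, q`. -/
def IsArraySolution {q n : ℕ} (M K : Matrix (Fin n) (Fin n) ℝ)
    (D R : Fin q → Fin q → Matrix (Fin n) (Fin n) ℝ)
    (x : Fin q → ℝ → EuclideanSpace ℝ (Fin n)) : Prop :=
  ∃ x' x'' : Fin q → ℝ → EuclideanSpace ℝ (Fin n),
    (∀ i t, HasDerivAt (x i) (x' i t) t) ∧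
    (∀ i t, HasDerivAt (x' i) (x'' i t) t) ∧
    ∀ i t, M *ᵥ (x'' i t).ofLp + K *ᵥ (x i t).ofLp
        + ∑ j, D i j *ᵥ (x' i t - x' j t).ofLp
        + ∑ j, R i j *ᵥ (x i t - x j t).ofLp = 0

/-- The array synchronizes: along every solution, `‖xᵢ(t) - xⱼ(t)‖ → 0` as `t → ∞` for all
`i, j`. -/
def Synchronizes {q n : ℕ} (M K : Matrix (Fin n) (Fin n) ℝ)
    (D R : Fin q → Fin q → Matrix (Fin n) (Fin n) ℝ) : Prop :=
  ∀ x : Fin q → ℝ → EuclideanSpace ℝ (Fin n), IsArraySolution M K D R x →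
    ∀ i j, Filter.Tendsto (fun t => ‖x i t - x j t‖) Filter.atTop (nhds 0)

/-- `M ^ (-1/2)`, the inverse of the positive semidefinite square root of `M`. -/
noncomputable def invSqrt {n : ℕ} (M : Matrix (Fin n) (Fin n) ℝ) : Matrix (Fin n) (Fin n) ℝ :=
  (CFC.sqrt M)⁻¹

/-- `P = M ^ (-1/2) * K * M ^ (-1/2)`. -/
noncomputable def normalized {n : ℕ} (M K : Matrix (Fin n) (Fin n) ℝ) :
    Matrix (Fin n) (Fin n) ℝ :=
  invSqrt M * K * invSqrt M

/-- The dissipative Laplacian `L_d = lap (M ^ (-1/2) * D i j * M ^ (-1/2))`. -/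
noncomputable def dissLap {q n : ℕ} (M : Matrix (Fin n) (Fin n) ℝ)
    (D : Fin q → Fin q → Matrix (Fin n) (Fin n) ℝ) :
    Matrix (Fin q × Fin n) (Fin q × Fin n) ℝ :=
  lap fun i j => invSqrt M * D i j * invSqrt M

/-- The `qn × q` matrix `I_q ⊗ v` for a column vector `v` of length `n`. -/
def idKron (q : ℕ) {n : ℕ} (v : Fin n → ℝ) : Matrix (Fin q × Fin n) (Fin q) ℝ :=
  ((1 : Matrix (Fin q) (Fin q) ℝ) ⊗ₖ Matrix.replicateCol Unit v).submatrix id fun i => (i, ())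

/-- The projection `[I_q ⊗ vᵀ] L [I_q ⊗ v]` of `L` along `v`. -/
def projLap {q n : ℕ} (L : Matrix (Fin q × Fin n) (Fin q × Fin n) ℝ) (v : Fin n → ℝ) :
    Matrix (Fin q) (Fin q) ℝ :=
  (idKron q v)ᵀ * L * idKron q v

theorem length_sort_re_roots_charpoly {m : ℕ} (X : Matrix (Fin m) (Fin m) ℂ) :
    ((X.charpoly.roots.map Complex.re).sort (· ≤ ·)).length = m := by
  rw [Multiset.length_sort, Multiset.card_map,
    ← (IsAlgClosed.splits X.charpoly).natDegree_eq_card_roots, X.charpoly_natDegree_eq_dim,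
    Fintype.card_fin]

/-- `eigRe X 0 ≤ eigRe X 1 ≤ ⋯ ≤ eigRe X (m - 1)` are the real parts of the `m` eigenvalues of
`X`, listed in increasing order and repeated according to algebraic multiplicity. So `eigRe X k`
is the real part of the `(k+1)`-st smallest eigenvalue `λ_{k+1}(X)` with respect to the real
part; it is the eigenvalue itself when `X` is a real symmetric matrix. -/
noncomputable def eigRe {m : ℕ} (X : Matrix (Fin m) (Fin m) ℂ) (k : Fin m) : ℝ :=
  ((X.charpoly.roots.map Complex.re).sort (· ≤ ·)).get
    (k.cast (length_sort_re_roots_charpoly X).symm)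

/-!
In the coordinates `y i = M ^ (1/2) x i` the array becomes `y'' + C y' + A y = 0` on the product
space, where `C` is the dissipative Laplacian and `A` is `I ⊗ P` plus `ε` times the restorative
Laplacian. Laplacians annihilate arrays with equal components, so the deviations of the `y i` from
their mean satisfy the same equation, and damping of the mean may be added to `C` for free. The
claim is then that this augmented damped system is asymptotically stable.

If `A` is positive definite and `C` is positive semidefinite, then the energy `⟪A y, y⟫ + ‖y'‖ ^ 2`
is nonincreasing, and it is constant on an interval only if `C y' = 0` there. In that case the
velocities span a subspace of `ker C` invariant under `A`, which is trivial as soon as no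
eigenvector of `A` lies in `ker C`. By compactness the energy then decays by a fixed fraction per
unit of time.

At `ε = 0` an eigenvector of `A` is of the form `u ⊗ v k`, because the eigenvalues of `P` are
distinct. If it is in the kernel of the dissipative Laplacian, then `G_kk u = 0`, so `u` is
constant by `λ₂(G_kk) > 0`, and the damping of the mean excludes `u ≠ 0`. Both requirements on `A`
are open conditions, hence they persist for small `ε`.
-/

open scoped InnerProductSpace Topology
open Filter
open Matrix (toEuclideanCLM)

section SecondEigenvalue

theorem get_le_of_lt_countP_of_pairwise {α : Type*} [LinearOrder α] {l : List α}
    (hl : l.Pairwise (· ≤ ·)) {a : α} {k : Fin l.length} (hk : k < l.countP (· ≤ a)) :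
    l.get k ≤ a := by
  by_contra! hlt
  refine hk.not_ge ?_
  have hdrop : (l.drop k).countP (· ≤ a) = 0 := by
    refine List.countP_eq_zero.2 fun b hb => ?_
    obtain ⟨i, hi, rfl⟩ := List.getElem_of_mem hb
    simp only [List.getElem_drop, decide_eq_true_eq, not_le]
    rw [List.length_drop] at hi
    exact hlt.trans_le (hl.sortedLE.getElem_le_getElem_of_le (by lia))
  calc l.countP (· ≤ a) = (l.take k).countP (· ≤ a) + (l.drop k).countP (· ≤ a) := by
        rw [← List.countP_append, List.take_append_drop]
    _ ≤ k := by
        rw [hdrop, add_zero]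
        exact List.countP_le_length.trans (List.length_take_le _ _)

theorem finrank_eigenspace_le_countP_re_roots {m : ℕ} (G : Matrix (Fin m) (Fin m) ℝ) (a : ℝ) :
    Module.finrank ℝ (Module.End.eigenspace (Matrix.toLin' G) a) ≤
      ((G.map Complex.ofReal).charpoly.roots.map Complex.re).countP (· ≤ a) := by
  have hmap : (G.map Complex.ofReal).charpoly = G.charpoly.map Complex.ofRealHom :=
    Matrix.charpoly_map G Complex.ofRealHom
  calc Module.finrank ℝ (Module.End.eigenspace (Matrix.toLin' G) a)
      ≤ (Matrix.toLin' G).charpoly.rootMultiplicity a := LinearMap.finrank_eigenspace_le _ _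
    _ = (G.map Complex.ofReal).charpoly.roots.count (a : ℂ) := by
        rw [Matrix.charpoly_toLin', Polynomial.count_roots, hmap]
        exact Polynomial.eq_rootMultiplicity_map (f := Complex.ofRealHom) Complex.ofReal_injective a
    _ ≤ ((G.map Complex.ofReal).charpoly.roots.map Complex.re).countP (· ≤ a) := by
        rw [Multiset.countP_map, Multiset.count, Multiset.countP_eq_card_filter]
        refine Multiset.card_le_card (Multiset.monotone_filter_right _ fun z hz => ?_)
        simp [← hz]

theorem eigRe_le_of_lt_finrank_eigenspace {m : ℕ} {G : Matrix (Fin m) (Fin m) ℝ} {a : ℝ}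
    {k : Fin m} (hk : k < Module.finrank ℝ (Module.End.eigenspace (Matrix.toLin' G) a)) :
    eigRe (G.map Complex.ofReal) k ≤ a := by
  refine get_le_of_lt_countP_of_pairwise (Multiset.pairwise_sort _ _) ?_
  rw [← Multiset.coe_countP, Multiset.sort_eq]
  exact hk.trans_le (finrank_eigenspace_le_countP_re_roots G a)

theorem eq_of_mulVec_eq_zero_of_eigRe_one_pos {m : ℕ} (hm : 1 < m)
    {G : Matrix (Fin m) (Fin m) ℝ} (hG : 0 < eigRe (G.map Complex.ofReal) ⟨1, hm⟩)
    (hone : G *ᵥ 1 = 0) {u : Fin m → ℝ} (hu : G *ᵥ u = 0) (i j : Fin m) : u i = u j := by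
  have hker {w : Fin m → ℝ} (hw : G *ᵥ w = 0) : w ∈ Module.End.eigenspace (Matrix.toLin' G) 0 := by
    simpa [Module.End.mem_eigenspace_iff] using hw
  have hfinrank : Module.finrank ℝ (Module.End.eigenspace (Matrix.toLin' G) 0) ≤ 1 := by
    by_contra! h
    exact hG.not_ge (eigRe_le_of_lt_finrank_eigenspace h)
  obtain ⟨⟨w, hw⟩, hspan⟩ := finrank_le_one_iff.1 hfinrank
  obtain ⟨c, hc⟩ := hspan ⟨1, hker hone⟩
  obtain ⟨d, hd⟩ := hspan ⟨u, hker hu⟩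
  have hcw (l : Fin m) : c * w l = 1 := congrFun (congrArg Subtype.val hc) l
  have hdw (l : Fin m) : d * w l = u l := congrFun (congrArg Subtype.val hd) l
  have hc0 : c ≠ 0 := left_ne_zero_of_mul_eq_one (hcw i)
  rw [← hdw i, ← hdw j, mul_left_cancel₀ hc0 ((hcw i).trans (hcw j).symm)]

end SecondEigenvalue

section DistinctEigenvalues

variable {𝕜 F ι : Type*} [Field 𝕜] [AddCommGroup F] [Module 𝕜 F]

theorem coord_apply_of_forall_apply_basis_eq_smul {f : Module.End 𝕜 F} {σ : ι → 𝕜}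
    (b : Module.Basis ι 𝕜 F) (hb : ∀ k, f (b k) = σ k • b k) (k : ι) (w : F) :
    b.coord k (f w) = σ k * b.coord k w := by
  have h : b.coord k ∘ₗ f = σ k • b.coord k := by
    refine b.ext fun l => ?_
    rcases eq_or_ne l k with rfl | hlk
    · simp [hb]
    · simp [hb, hlk]
  exact LinearMap.congr_fun h w

theorem exists_eigenspace_le_span_singleton [FiniteDimensional 𝕜 F] [Fintype ι]
    {f : Module.End 𝕜 F} {σ : ι → 𝕜} (hσ : Function.Injective σ) {v : ι → F}
    (hv : ∀ k, f.HasEigenvector (σ k) (v k)) (hcard : Fintype.card ι = Module.finrank 𝕜 F)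
    {μ : 𝕜} (hμ : f.HasEigenvalue μ) :
    ∃ k, f.eigenspace μ ≤ Submodule.span 𝕜 {v k} := by
  obtain ⟨w, hw⟩ := hμ.exists_hasEigenvector
  let b := basisOfLinearIndependentOfCardEqFinrank' v
    (Module.End.eigenvectors_linearIndependent' f σ hσ v hv) hcard
  have hbv (k : ι) : b k = v k := by simp [b]
  have hcoord {x : F} (hx : x ∈ f.eigenspace μ) {k : ι} (hk : b.coord k x ≠ 0) : σ k = μ := by
    refine mul_right_cancel₀ hk ?_
    rw [← coord_apply_of_forall_apply_basis_eq_smul b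
      (fun l => by rw [hbv, (hv l).apply_eq_smul]), Module.End.mem_eigenspace_iff.1 hx, map_smul,
      smul_eq_mul]
  obtain ⟨k, hk⟩ : ∃ k, b.coord k w ≠ 0 := by
    by_contra! h
    exact hw.2 (b.forall_coord_eq_zero_iff.1 h)
  refine ⟨k, fun x hx => Submodule.mem_span_singleton.2 ⟨b.coord k x, ?_⟩⟩
  have hzero (l : ι) (hl : l ≠ k) : b.repr x l = 0 := by
    by_contra hxl
    exact hl (hσ ((hcoord hx hxl).trans (hcoord hw.1 hk).symm))
  conv_rhs => rw [← b.sum_repr x]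
  rw [Fintype.sum_eq_single k fun l hl => by rw [hzero l hl, zero_smul], hbv, b.coord_apply]

end DistinctEigenvalues

section Observability

variable {V : Type*} [NormedAddCommGroup V] [InnerProductSpace ℝ V]

/-- Observability of `y'' + A y = 0` through `C y'` for a symmetric operator `A`, in the form of
the Hautus test: no eigenvector of `A` lies in the kernel of `C`. Real eigenvalues suffice because
`A` is meant to be symmetric. -/
def IsObservable (A C : V →L[ℝ] V) : Prop :=
  ∀ (μ : ℝ) (w : V), A w = μ • w → C w = 0 → w = 0

theorem forall_pos_iff_forall_mem_sphere_pos {W : Type*} [NormedAddCommGroup W] [NormedSpace ℝ W]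
    {G : W → ℝ} (hG : ∀ (c : ℝ) x, G (c • x) = c ^ 2 * G x) :
    (∀ x, x ≠ 0 → 0 < G x) ↔ ∀ x ∈ Metric.sphere (0 : W) 1, 0 < G x := by
  refine ⟨fun h x hx => h x (ne_zero_of_mem_unit_sphere ⟨x, hx⟩), fun h x hx => ?_⟩
  have hpos := h (‖x‖⁻¹ • x) (by simp [norm_smul, hx])
  rw [hG] at hpos
  exact pos_of_mul_pos_right hpos (sq_nonneg _)

theorem isObservable_iff_forall_mem_sphere_pos {A C : V →L[ℝ] V} :
    IsObservable A C ↔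
      ∀ w ∈ Metric.sphere (0 : V) 1, 0 < ‖A w - ⟪A w, w⟫_ℝ • w‖ + ‖C w‖ := by
  constructor
  · intro h w hw
    refine lt_of_le_of_ne (by positivity) fun h0 => ne_zero_of_mem_unit_sphere ⟨w, hw⟩ ?_
    obtain ⟨hAw, hCw⟩ := (add_eq_zero_iff_of_nonneg (norm_nonneg _) (norm_nonneg _)).1 h0.symm
    exact h _ w (sub_eq_zero.1 (norm_eq_zero.1 hAw)) (norm_eq_zero.1 hCw)
  · intro h μ w hAw hCw
    by_contra hw
    have hu : ‖‖w‖⁻¹ • w‖ = 1 := by simp [norm_smul, hw]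
    have hAu : A (‖w‖⁻¹ • w) = μ • ‖w‖⁻¹ • w := by rw [map_smul, hAw, smul_comm]
    have hCu : C (‖w‖⁻¹ • w) = 0 := by rw [map_smul, hCw, smul_zero]
    have hpos := h (‖w‖⁻¹ • w) (mem_sphere_zero_iff_norm.2 hu)
    rw [hAu, hCu, real_inner_smul_left, real_inner_self_eq_norm_sq, hu] at hpos
    simp at hpos

section FiniteDimensional

variable [FiniteDimensional ℝ V]

theorem isOpen_setOf_forall_mem_sphere_pos {T : Type*} [TopologicalSpace T] {F : T → V → ℝ}
    (hF : Continuous fun p : T × V => F p.1 p.2) :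
    IsOpen {a | ∀ x ∈ Metric.sphere (0 : V) 1, 0 < F a x} :=
  isOpen_iff_mem_nhds.2 fun _ ha =>
    (isCompact_sphere (0 : V) 1).eventually_forall_of_forall_eventually fun x hx =>
      hF.continuousAt.eventually_const_lt (ha x hx)

theorem isOpen_setOf_isObservable (C : V →L[ℝ] V) :
    IsOpen {A : V →L[ℝ] V | IsObservable A C} := by
  simp only [isObservable_iff_forall_mem_sphere_pos]
  exact isOpen_setOf_forall_mem_sphere_pos (by fun_prop)

theorem isOpen_setOf_forall_inner_self_pos :
    IsOpen {A : V →L[ℝ] V | ∀ x, x ≠ 0 → 0 < ⟪A x, x⟫_ℝ} := by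
  have hsq (A : V →L[ℝ] V) (c : ℝ) (x : V) : ⟪A (c • x), c • x⟫_ℝ = c ^ 2 * ⟪A x, x⟫_ℝ := by
    rw [map_smul, real_inner_smul_left, real_inner_smul_right, sq, mul_assoc]
  have hiff (A : V →L[ℝ] V) :=
    forall_pos_iff_forall_mem_sphere_pos (G := fun x => ⟪A x, x⟫_ℝ) (hsq A)
  simp only [hiff]
  exact isOpen_setOf_forall_mem_sphere_pos (by fun_prop)

theorem exists_pos_forall_mul_sq_norm_le {W : Type*} [NormedAddCommGroup W] [NormedSpace ℝ W]
    [FiniteDimensional ℝ W] {G : W → ℝ} (hcont : Continuous G)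
    (hG : ∀ (c : ℝ) x, G (c • x) = c ^ 2 * G x) (hpos : ∀ x, x ≠ 0 → 0 < G x) :
    ∃ m > 0, ∀ x, m * ‖x‖ ^ 2 ≤ G x := by
  have h0 : G 0 = 0 := by simpa using hG 0 0
  obtain ⟨m, hm, hle⟩ := (isCompact_sphere (0 : W) 1).exists_forall_le' hcont.continuousOn
    ((forall_pos_iff_forall_mem_sphere_pos hG).1 hpos)
  refine ⟨m, hm, fun x => ?_⟩
  rcases eq_or_ne x 0 with rfl | hx
  · simp [h0]
  have hx' : ‖x‖ ≠ 0 := norm_ne_zero_iff.2 hx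
  calc m * ‖x‖ ^ 2 ≤ G (‖x‖⁻¹ • x) * ‖x‖ ^ 2 := by
        gcongr
        exact hle _ (by simp [norm_smul, hx])
    _ = G x := by
        rw [hG]
        field_simp

theorem IsObservable.eq_bot_of_invariant {A C : V →L[ℝ] V} (hobs : IsObservable A C)
    (hA : A.IsSymmetric) {S : Submodule ℝ V} (hAS : ∀ x ∈ S, A x ∈ S)
    (hCS : ∀ x ∈ S, C x = 0) : S = ⊥ := by
  by_contra hS
  have : Nontrivial S := Submodule.nontrivial_iff_ne_bot.2 hS
  obtain ⟨u, hu⟩ :=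
    (hA.restrict_invariant hAS).hasEigenvalue_iSup_of_finiteDimensional.exists_hasEigenvector
  exact hu.2 (Subtype.ext
    (hobs _ u (by simpa using congrArg Subtype.val hu.apply_eq_smul) (hCS u u.2)))

end FiniteDimensional

theorem map_eq_zero_of_inner_map_self_eq_zero {C : V →L[ℝ] V} (hC : C.IsPositive) {x : V}
    (hx : ⟪C x, x⟫_ℝ = 0) : C x = 0 := by
  have hCx : ⟪C (C x), x⟫_ℝ = ⟪C x, C x⟫_ℝ := hC.isSymmetric (C x) x
  have hle : ⟪C x, C x⟫_ℝ * ⟪C (C x), x⟫_ℝ ≤ ⟪C x, x⟫_ℝ * ⟪C (C x), C x⟫_ℝ :=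
    LinearMap.BilinForm.apply_mul_apply_le_of_forall_zero_le
      ((innerₗ V).comp (C : V →ₗ[ℝ] V)) hC.inner_nonneg_left x (C x)
  rw [hCx, hx, zero_mul] at hle
  exact inner_self_eq_zero.1 (mul_self_eq_zero.1 (hle.antisymm (mul_self_nonneg _)))

end Observability

section LinearFlow

variable {W : Type*} [NormedAddCommGroup W] [NormedSpace ℝ W]

/-- The time-`t` map of the linear system `X' = B X`. -/
noncomputable def linearFlow (B : W →L[ℝ] W) (t : ℝ) : W →L[ℝ] W :=
  NormedSpace.exp (t • B)

theorem linearFlow_zero (B : W →L[ℝ] W) : linearFlow B 0 = 1 := by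
  rw [linearFlow, zero_smul, NormedSpace.exp_zero]

theorem hasDerivAt_linearFlow_apply [CompleteSpace W] (B : W →L[ℝ] W) (x : W) (t : ℝ) :
    HasDerivAt (fun s => linearFlow B s x) (B (linearFlow B t x)) t :=
  (ContinuousLinearMap.apply ℝ W x).hasFDerivAt.comp_hasDerivAt t
    (hasDerivAt_exp_smul_const' (𝕂 := ℝ) B t)

theorem eq_linearFlow_apply_of_hasDerivAt [CompleteSpace W] {B : W →L[ℝ] W} {X : ℝ → W}
    (hX : ∀ t, HasDerivAt X (B (X t)) t) (s t : ℝ) : X (s + t) = linearFlow B t (X s) := by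
  have huniq := ODE_solution_unique_univ (v := fun _ => B) (s := fun _ => Set.univ) (K := ‖B‖₊)
    (f := fun t => X (s + t)) (g := fun t => linearFlow B t (X s)) (t₀ := 0)
    (fun _ => B.lipschitz.lipschitzOnWith)
    (fun t => ⟨(hX (s + t)).comp_const_add s t, trivial⟩)
    (fun t => ⟨hasDerivAt_linearFlow_apply B (X s) t, trivial⟩) (by simp [linearFlow_zero])
  exact congrFun huniq t

end LinearFlow

section DampedSystem

variable {V : Type*} [NormedAddCommGroup V] [InnerProductSpace ℝ V]

/-- The trajectory `y` solves the second-order system `y'' + C y' + A y = 0`. -/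
def IsDampedSolution (A C : V →L[ℝ] V) (y : ℝ → V) : Prop :=
  ∃ y' y'' : ℝ → V, (∀ t, HasDerivAt y (y' t) t) ∧ (∀ t, HasDerivAt y' (y'' t) t) ∧
    ∀ t, y'' t + C (y' t) + A (y t) = 0

/-- The linear vector field of `y'' + C y' + A y = 0` on the phase space of pairs `(y, y')`. -/
noncomputable def dampedField (A C : V →L[ℝ] V) : V × V →L[ℝ] V × V :=
  (ContinuousLinearMap.snd ℝ V V).prod
    (-(C ∘L ContinuousLinearMap.snd ℝ V V) - A ∘L ContinuousLinearMap.fst ℝ V V)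

/-- Twice the energy `‖y'‖² + ⟪A y, y⟫` of the state `(y, y')` of `y'' + C y' + A y = 0`. -/
noncomputable def dampedEnergy (A : V →L[ℝ] V) (X : V × V) : ℝ :=
  ⟪X.2, X.2⟫_ℝ + ⟪A X.1, X.1⟫_ℝ

theorem continuous_dampedEnergy (A : V →L[ℝ] V) : Continuous (dampedEnergy A) := by
  unfold dampedEnergy
  fun_prop

theorem dampedEnergy_smul (A : V →L[ℝ] V) (c : ℝ) (X : V × V) :
    dampedEnergy A (c • X) = c ^ 2 * dampedEnergy A X := by
  simp only [dampedEnergy, Prod.smul_fst, Prod.smul_snd, map_smul, real_inner_smul_left,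
    real_inner_smul_right]
  ring

variable {A C : V →L[ℝ] V}

theorem dampedEnergy_pos (hApos : ∀ x, x ≠ 0 → 0 < ⟪A x, x⟫_ℝ) {X : V × V}
    (hX : X ≠ 0) : 0 < dampedEnergy A X := by
  rcases eq_or_ne X.1 0 with h1 | h1
  · have h2 : X.2 ≠ 0 := fun h2 => hX (Prod.ext h1 h2)
    simpa [dampedEnergy, h1] using real_inner_self_pos.2 h2
  · exact add_pos_of_nonneg_of_pos real_inner_self_nonneg (hApos _ h1)

theorem dampedEnergy_nonneg (hApos : ∀ x, x ≠ 0 → 0 < ⟪A x, x⟫_ℝ)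
    (X : V × V) : 0 ≤ dampedEnergy A X := by
  rcases eq_or_ne X 0 with rfl | hX
  · simp [dampedEnergy]
  · exact (dampedEnergy_pos hApos hX).le

theorem hasDerivAt_dampedEnergy (hA : A.IsSymmetric) {X : ℝ → V × V} {t : ℝ}
    (hX : HasDerivAt X (dampedField A C (X t)) t) :
    HasDerivAt (fun s => dampedEnergy A (X s)) (-2 * ⟪C (X t).2, (X t).2⟫_ℝ) t := by
  have hpos : HasDerivAt (fun s => (X s).1) (X t).2 t := hX.fst
  have hvel : HasDerivAt (fun s => (X s).2) (-C (X t).2 - A (X t).1) t := hX.snd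
  have hforce : HasDerivAt (fun s => A (X s).1) (A (X t).2) t :=
    A.hasFDerivAt.comp_hasDerivAt t hpos
  refine ((hvel.inner ℝ hvel).add (hforce.inner ℝ hpos)).congr_deriv ?_
  have hsymm : ⟪A (X t).2, (X t).1⟫_ℝ = ⟪(X t).2, A (X t).1⟫_ℝ := hA _ _
  simp only [inner_sub_left, inner_sub_right, inner_neg_left, inner_neg_right, hsymm]
  rw [real_inner_comm (A (X t).1) (X t).2, real_inner_comm (C (X t).2) (X t).2]
  ring

theorem antitone_dampedEnergy (hA : A.IsSymmetric) (hC : C.IsPositive)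
    {X : ℝ → V × V} (hX : ∀ t, HasDerivAt X (dampedField A C (X t)) t) :
    Antitone fun t => dampedEnergy A (X t) :=
  antitone_of_hasDerivAt_nonpos (fun t => hasDerivAt_dampedEnergy hA (hX t)) fun t =>
    mul_nonpos_of_nonpos_of_nonneg (by norm_num) (hC.inner_nonneg_left _)

theorem deriv_mem_of_eventually_mem {W : Type*} [NormedAddCommGroup W] [NormedSpace ℝ W]
    {S : Submodule ℝ W} (hS : IsClosed (S : Set W)) {f : ℝ → W} {f' : W} {t : ℝ}
    (hf : HasDerivAt f f' t) (hmem : ∀ᶠ s in 𝓝 t, f s ∈ S) : f' ∈ S := by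
  refine hS.mem_of_tendsto hf.tendsto_slope ?_
  filter_upwards [hmem.filter_mono nhdsWithin_le_nhds] with s hs
  exact S.smul_mem _ (S.sub_mem hs hmem.self_of_nhds)

theorem eqOn_zero_of_map_snd_eq_zero [FiniteDimensional ℝ V]
    (hA : A.IsSymmetric) (hApos : ∀ x, x ≠ 0 → 0 < ⟪A x, x⟫_ℝ) (hobs : IsObservable A C)
    {X : ℝ → V × V} (hX : ∀ t, HasDerivAt X (dampedField A C (X t)) t) {s : Set ℝ}
    (hs : IsOpen s) (hC : ∀ t ∈ s, C (X t).2 = 0) : s.EqOn X 0 := by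
  have hpos (t) : HasDerivAt (fun s => (X s).1) (X t).2 t := (hX t).fst
  have hvel (t) (ht : t ∈ s) : HasDerivAt (fun s => (X s).2) (-A (X t).1) t := by
    have hvel : HasDerivAt (fun s => (X s).2) (-C (X t).2 - A (X t).1) t := (hX t).snd
    rwa [hC t ht, neg_zero, zero_sub] at hvel
  let S : Submodule ℝ V := Submodule.span ℝ ((fun t => (X t).2) '' s)
  have hSclosed : IsClosed (S : Set V) := S.closed_of_finiteDimensional
  have hvS (t) (ht : t ∈ s) : (X t).2 ∈ S := Submodule.subset_span ⟨t, ht, rfl⟩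
  have hAyS (t) (ht : t ∈ s) : A (X t).1 ∈ S :=
    neg_mem_iff.1 (deriv_mem_of_eventually_mem hSclosed (hvel t ht)
      (Filter.mem_of_superset (hs.mem_nhds ht) hvS))
  have hAvS (t) (ht : t ∈ s) : A (X t).2 ∈ S :=
    deriv_mem_of_eventually_mem hSclosed (A.hasFDerivAt.comp_hasDerivAt t (hpos t))
      (Filter.mem_of_superset (hs.mem_nhds ht) hAyS)
  have hS : S = ⊥ := by
    refine hobs.eq_bot_of_invariant hA (S := S)
      (Submodule.span_le (p := S.comap (A : V →ₗ[ℝ] V)).2 ?_)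
      (Submodule.span_le (p := LinearMap.ker (C : V →ₗ[ℝ] V)).2 ?_)
    · rintro _ ⟨t, ht, rfl⟩
      exact hAvS t ht
    · rintro _ ⟨t, ht, rfl⟩
      exact hC t ht
  intro t ht
  have hv : (X t).2 = 0 := by simpa [hS] using hvS t ht
  have hAy : A (X t).1 = 0 := by simpa [hS] using hAyS t ht
  refine Prod.ext ?_ hv
  by_contra hy
  simpa [hAy] using hApos _ hy

theorem dampedEnergy_one_lt [FiniteDimensional ℝ V] (hA : A.IsSymmetric)
    (hApos : ∀ x, x ≠ 0 → 0 < ⟪A x, x⟫_ℝ) (hC : C.IsPositive) (hobs : IsObservable A C)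
    {X : ℝ → V × V} (hX : ∀ t, HasDerivAt X (dampedField A C (X t)) t) (h0 : X 0 ≠ 0) :
    dampedEnergy A (X 1) < dampedEnergy A (X 0) := by
  have hanti := antitone_dampedEnergy hA hC hX
  refine lt_of_not_ge fun hge => (dampedEnergy_pos hApos h0).ne' ?_
  have hconst (t) (ht : t ∈ Set.Ioo (0 : ℝ) 1) : dampedEnergy A (X t) = dampedEnergy A (X 0) :=
    le_antisymm (hanti ht.1.le) (hge.trans (hanti ht.2.le))
  have hCv (t) (ht : t ∈ Set.Ioo (0 : ℝ) 1) : C (X t).2 = 0 := by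
    have hderiv : HasDerivAt (fun s => dampedEnergy A (X s)) 0 t :=
      (hasDerivAt_const t (dampedEnergy A (X 0))).congr_of_eventuallyEq
        (Filter.mem_of_superset (isOpen_Ioo.mem_nhds ht) hconst)
    refine map_eq_zero_of_inner_map_self_eq_zero hC ?_
    linarith [(hasDerivAt_dampedEnergy hA (hX t)).unique hderiv]
  have hhalf : (1 / 2 : ℝ) ∈ Set.Ioo (0 : ℝ) 1 := by norm_num
  have hzero := eqOn_zero_of_map_snd_eq_zero hA hApos hobs hX isOpen_Ioo hCv hhalf
  rw [← hconst _ hhalf, hzero]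
  simp [dampedEnergy]

theorem exists_pos_forall_mul_sq_norm_le_dampedEnergy_sub [FiniteDimensional ℝ V]
    (hA : A.IsSymmetric) (hApos : ∀ x, x ≠ 0 → 0 < ⟪A x, x⟫_ℝ)
    (hC : C.IsPositive) (hobs : IsObservable A C) :
    ∃ m > 0, ∀ X : ℝ → V × V, (∀ t, HasDerivAt X (dampedField A C (X t)) t) →
      ∀ t, m * ‖X t‖ ^ 2 ≤ dampedEnergy A (X t) - dampedEnergy A (X (t + 1)) := by
  set Φ := linearFlow (dampedField A C) with hΦ
  obtain ⟨m, hm, hle⟩ := exists_pos_forall_mul_sq_norm_le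
    (G := fun x => dampedEnergy A x - dampedEnergy A (Φ 1 x))
    ((continuous_dampedEnergy A).sub ((continuous_dampedEnergy A).comp (Φ 1).continuous))
    (fun c x => by simp only [map_smul, dampedEnergy_smul, mul_sub])
    (fun x hx => by
      have hlt := dampedEnergy_one_lt hA hApos hC hobs
        (hasDerivAt_linearFlow_apply (dampedField A C) x) (by simpa [linearFlow_zero] using hx)
      simpa [hΦ, linearFlow_zero] using hlt)
  refine ⟨m, hm, fun X hX t => ?_⟩
  rw [eq_linearFlow_apply_of_hasDerivAt hX]
  exact hle (X t)

theorem tendsto_zero_of_hasDerivAt_dampedField [FiniteDimensional ℝ V]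
    (hA : A.IsSymmetric) (hApos : ∀ x, x ≠ 0 → 0 < ⟪A x, x⟫_ℝ) (hC : C.IsPositive)
    (hobs : IsObservable A C) {X : ℝ → V × V}
    (hX : ∀ t, HasDerivAt X (dampedField A C (X t)) t) : Tendsto X atTop (𝓝 0) := by
  obtain ⟨m, hm, hle⟩ := exists_pos_forall_mul_sq_norm_le_dampedEnergy_sub hA hApos hC hobs
  have hE : Tendsto (fun t => dampedEnergy A (X t)) atTop (𝓝 (⨅ t, dampedEnergy A (X t))) :=
    tendsto_atTop_ciInf (antitone_dampedEnergy hA hC hX)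
      ⟨0, Set.forall_mem_range.2 fun t => dampedEnergy_nonneg hApos (X t)⟩
  have hdrop : Tendsto (fun t => (dampedEnergy A (X t) - dampedEnergy A (X (t + 1))) / m) atTop
      (𝓝 0) := by
    simpa using (hE.sub (hE.comp (tendsto_atTop_add_const_right atTop 1 tendsto_id))).div_const m
  have hsq : Tendsto (fun t => ‖X t‖ ^ 2) atTop (𝓝 0) :=
    squeeze_zero (fun t => sq_nonneg _) (fun t => (le_div_iff₀' hm).2 (hle X hX t)) hdrop
  exact tendsto_zero_iff_norm_tendsto_zero.2 (by simpa using hsq.sqrt)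

theorem IsDampedSolution.tendsto_zero [FiniteDimensional ℝ V] {y : ℝ → V}
    (hy : IsDampedSolution A C y) (hA : A.IsSymmetric) (hApos : ∀ x, x ≠ 0 → 0 < ⟪A x, x⟫_ℝ)
    (hC : C.IsPositive) (hobs : IsObservable A C) : Tendsto y atTop (𝓝 0) := by
  obtain ⟨y', y'', hy', hy'', heq⟩ := hy
  have hX (t) : HasDerivAt (fun t => (y t, y' t)) (dampedField A C (y t, y' t)) t := by
    refine ((hy' t).prodMk (hy'' t)).congr_deriv (Prod.ext rfl ?_)
    calc y'' t = -(C (y' t)) - A (y t) + (y'' t + C (y' t) + A (y t)) := by abel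
      _ = -(C (y' t)) - A (y t) := by rw [heq, add_zero]
  exact (continuous_fst.tendsto (0 : V × V)).comp
    (tendsto_zero_of_hasDerivAt_dampedField hA hApos hC hobs hX)

end DampedSystem

section Array

variable {ι E : Type*} [Fintype ι] [NormedAddCommGroup E] [InnerProductSpace ℝ E]

/-- The operator `I ⊗ P` acting by `P` on each component of an array. -/
noncomputable def diagOp (ι : Type*) [Fintype ι] (P : E →L[ℝ] E) :
    PiLp 2 (fun _ : ι => E) →L[ℝ] PiLp 2 (fun _ : ι => E) :=
  (PiLp.continuousLinearEquiv 2 ℝ fun _ : ι => E).symm ∘L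
    ContinuousLinearMap.pi fun i => P ∘L PiLp.proj 2 (fun _ : ι => E) i

/-- The operator-weighted Laplacian with weights `T i j`, written through the differences of the
components so that the diagonal weights `T i i` do not matter. -/
noncomputable def lapOp (T : ι → ι → E →L[ℝ] E) :
    PiLp 2 (fun _ : ι => E) →L[ℝ] PiLp 2 (fun _ : ι => E) :=
  (PiLp.continuousLinearEquiv 2 ℝ fun _ : ι => E).symm ∘L
    ContinuousLinearMap.pi fun i => ∑ j, T i j ∘L
      (PiLp.proj (𝕜 := ℝ) 2 (fun _ : ι => E) i - PiLp.proj 2 (fun _ : ι => E) j)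

/-- The operator replacing every component of an array by the sum of all components. It provides
artificial damping of the mean, which the Laplacian does not see. -/
noncomputable def sumOp (ι E : Type*) [Fintype ι] [NormedAddCommGroup E]
    [InnerProductSpace ℝ E] : PiLp 2 (fun _ : ι => E) →L[ℝ] PiLp 2 (fun _ : ι => E) :=
  (PiLp.continuousLinearEquiv 2 ℝ fun _ : ι => E).symm ∘L
    ContinuousLinearMap.pi fun _ : ι => ∑ j, PiLp.proj 2 (fun _ : ι => E) j

/-- The projection onto arrays of mean zero, subtracting the mean from every component. -/
noncomputable def centeringOp (ι E : Type*) [Fintype ι] [NormedAddCommGroup E]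
    [InnerProductSpace ℝ E] : PiLp 2 (fun _ : ι => E) →L[ℝ] PiLp 2 (fun _ : ι => E) :=
  .id ℝ _ - (Fintype.card ι : ℝ)⁻¹ • sumOp ι E

@[simp]
theorem diagOp_apply (P : E →L[ℝ] E) (w : PiLp 2 fun _ : ι => E) (i : ι) :
    diagOp ι P w i = P (w i) := rfl

@[simp]
theorem lapOp_apply (T : ι → ι → E →L[ℝ] E) (w : PiLp 2 fun _ : ι => E) (i : ι) :
    lapOp T w i = ∑ j, T i j (w i - w j) := by
  simp [lapOp]

@[simp]
theorem sumOp_apply (w : PiLp 2 fun _ : ι => E) (i : ι) : sumOp ι E w i = ∑ j, w j := by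
  simp [sumOp]

@[simp]
theorem centeringOp_apply (w : PiLp 2 fun _ : ι => E) (i : ι) :
    centeringOp ι E w i = w i - (Fintype.card ι : ℝ)⁻¹ • ∑ j, w j := by
  simp [centeringOp]

theorem hasDerivAt_diagOp_toLp (P : E →L[ℝ] E) {y y' : ι → ℝ → E}
    (hy : ∀ i t, HasDerivAt (y i) (y' i t) t) (t : ℝ) :
    HasDerivAt (fun t => diagOp ι P (WithLp.toLp 2 (y · t)))
      (diagOp ι P (WithLp.toLp 2 (y' · t))) t :=
  (diagOp ι P).hasFDerivAt.comp_hasDerivAt t <|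
    (PiLp.hasFDerivAt_toLp 2 (y · t)).comp_hasDerivAt t <| hasDerivAt_pi.2 fun i => hy i t

theorem lapOp_smul (c : ℝ) (T : ι → ι → E →L[ℝ] E) :
    lapOp (fun i j => c • T i j) = c • lapOp T := by
  ext w i
  simp [Finset.smul_sum, smul_sub]

theorem isSymmetric_diagOp {P : E →L[ℝ] E} (hP : P.IsSymmetric) : (diagOp ι P).IsSymmetric :=
  fun w w' => Finset.sum_congr rfl fun i _ => hP (w i) (w' i)

theorem inner_diagOp_self_pos {P : E →L[ℝ] E} (hPpos : ∀ x, x ≠ 0 → 0 < ⟪P x, x⟫_ℝ)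
    {w : PiLp 2 fun _ : ι => E} (hw : w ≠ 0) : 0 < ⟪diagOp ι P w, w⟫_ℝ := by
  have hnonneg (x : E) : 0 ≤ ⟪P x, x⟫_ℝ := by
    rcases eq_or_ne x 0 with rfl | hx
    · simp
    · exact (hPpos x hx).le
  obtain ⟨i, hi⟩ : ∃ i, w i ≠ 0 := by
    by_contra! h
    exact hw (PiLp.ext h)
  exact Finset.sum_pos' (fun j _ => hnonneg (w j)) ⟨i, Finset.mem_univ _, hPpos _ hi⟩

theorem isPositive_sumOp : (sumOp ι E).IsPositive := by
  have hinner (w w' : PiLp 2 fun _ : ι => E) :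
      ⟪sumOp ι E w, w'⟫_ℝ = ⟪∑ i, w i, ∑ i, w' i⟫_ℝ := by
    simp only [PiLp.inner_apply, sumOp_apply, inner_sum]
  refine (ContinuousLinearMap.isPositive_iff _).2 ⟨fun w w' => ?_, fun w => ?_⟩
  · simp only [ContinuousLinearMap.coe_coe]
    rw [real_inner_comm (sumOp ι E w') w, hinner, hinner, real_inner_comm]
  · rw [hinner]
    exact real_inner_self_nonneg

section Laplacian

variable {T : ι → ι → E →L[ℝ] E} (hT : ∀ i j, T i j = T j i)
include hT

theorem two_mul_inner_lapOp (w w' : PiLp 2 fun _ : ι => E) :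
    2 * ⟪lapOp T w, w'⟫_ℝ = ∑ i, ∑ j, ⟪T i j (w i - w j), w' i - w' j⟫_ℝ := by
  have hleft : ⟪lapOp T w, w'⟫_ℝ = ∑ i, ∑ j, ⟪T i j (w i - w j), w' i⟫_ℝ := by
    simp only [PiLp.inner_apply, lapOp_apply, sum_inner]
  have hright : ⟪lapOp T w, w'⟫_ℝ = -∑ i, ∑ j, ⟪T i j (w i - w j), w' j⟫_ℝ := by
    rw [hleft, Finset.sum_comm, ← Finset.sum_neg_distrib]
    refine Finset.sum_congr rfl fun i _ => ?_
    rw [← Finset.sum_neg_distrib]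
    refine Finset.sum_congr rfl fun j _ => ?_
    rw [hT j i, ← inner_neg_left, ← map_neg, neg_sub]
  simp only [inner_sub_right, Finset.sum_sub_distrib]
  linarith

theorem isSymmetric_lapOp (hTsymm : ∀ i j, (T i j).IsSymmetric) : (lapOp T).IsSymmetric := by
  intro w w'
  simp only [ContinuousLinearMap.coe_coe]
  rw [real_inner_comm (lapOp T w') w]
  refine mul_left_cancel₀ (two_ne_zero (α := ℝ)) ?_
  rw [two_mul_inner_lapOp hT, two_mul_inner_lapOp hT]
  refine Finset.sum_congr rfl fun i _ => Finset.sum_congr rfl fun j _ => ?_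
  rw [real_inner_comm]
  exact (hTsymm i j _ _).symm

theorem isPositive_lapOp (hTpos : ∀ i j, (T i j).IsPositive) : (lapOp T).IsPositive := by
  refine (ContinuousLinearMap.isPositive_iff _).2
    ⟨isSymmetric_lapOp hT fun i j => (hTpos i j).isSymmetric, fun w => ?_⟩
  have hsum : 0 ≤ ∑ i, ∑ j, ⟪T i j (w i - w j), w i - w j⟫_ℝ :=
    Finset.sum_nonneg fun i _ => Finset.sum_nonneg fun j _ => (hTpos i j).inner_nonneg_left _
  linarith [two_mul_inner_lapOp hT w w]

theorem sum_lapOp_apply (w : PiLp 2 fun _ : ι => E) : ∑ i, lapOp T w i = 0 := by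
  simp only [lapOp_apply, map_sub, Finset.sum_sub_distrib]
  rw [sub_eq_zero, Finset.sum_comm]
  exact Finset.sum_congr rfl fun i _ => Finset.sum_congr rfl fun j _ => by rw [hT]

theorem centeringOp_lapOp (w : PiLp 2 fun _ : ι => E) :
    centeringOp ι E (lapOp T w) = lapOp T w := by
  ext i
  rw [centeringOp_apply, sum_lapOp_apply hT, smul_zero, sub_zero]

end Laplacian

theorem lapOp_centeringOp (T : ι → ι → E →L[ℝ] E) (w : PiLp 2 fun _ : ι => E) :
    lapOp T (centeringOp ι E w) = lapOp T w := by
  ext i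
  simp only [lapOp_apply, centeringOp_apply, sub_sub_sub_cancel_right]

theorem centeringOp_diagOp (P : E →L[ℝ] E) (w : PiLp 2 fun _ : ι => E) :
    centeringOp ι E (diagOp ι P w) = diagOp ι P (centeringOp ι E w) := by
  ext i
  simp only [centeringOp_apply, diagOp_apply, map_sub, map_smul, map_sum]

theorem sumOp_centeringOp (w : PiLp 2 fun _ : ι => E) : sumOp ι E (centeringOp ι E w) = 0 := by
  ext i
  have : Nonempty ι := ⟨i⟩
  have hcard : (Fintype.card ι : ℝ) ≠ 0 := Nat.cast_ne_zero.2 Fintype.card_ne_zero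
  simp only [sumOp_apply, centeringOp_apply, Finset.sum_sub_distrib, Finset.sum_const,
    Finset.card_univ, ← Nat.cast_smul_eq_nsmul ℝ, smul_inv_smul₀ hcard, sub_self, PiLp.zero_apply]

theorem IsDampedSolution.centering {P : E →L[ℝ] E} {S T : ι → ι → E →L[ℝ] E}
    {z : ℝ → PiLp 2 fun _ : ι => E} (hS : ∀ i j, S i j = S j i) (hT : ∀ i j, T i j = T j i)
    (hz : IsDampedSolution (diagOp ι P + lapOp S) (lapOp T) z) :
    IsDampedSolution (diagOp ι P + lapOp S) (lapOp T + sumOp ι E)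
      fun t => centeringOp ι E (z t) := by
  obtain ⟨z', z'', hz', hz'', heq⟩ := hz
  refine ⟨fun t => centeringOp ι E (z' t), fun t => centeringOp ι E (z'' t),
    fun t => (centeringOp ι E).hasFDerivAt.comp_hasDerivAt t (hz' t),
    fun t => (centeringOp ι E).hasFDerivAt.comp_hasDerivAt t (hz'' t), fun t => ?_⟩
  have h := congrArg (centeringOp ι E) (heq t)
  simp only [add_apply, map_add, map_zero, centeringOp_diagOp, centeringOp_lapOp hS,
    centeringOp_lapOp hT] at h
  simpa only [add_apply, lapOp_centeringOp, sumOp_centeringOp, add_zero] using h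

theorem isObservable_diagOp {P : E →L[ℝ] E} {T : ι → ι → E →L[ℝ] E}
    (hT : ∀ i j, T i j = T j i)
    (hsync : ∀ (μ : ℝ) (w : PiLp 2 fun _ : ι => E), (∀ i, P (w i) = μ • w i) →
      lapOp T w = 0 → ∀ i j, w i = w j) :
    IsObservable (diagOp ι P) (lapOp T + sumOp ι E) := by
  intro μ w hPw hCw
  have hcomp (i : ι) : lapOp T w i + ∑ j, w j = 0 := by
    simpa using congrArg (fun u : PiLp 2 fun _ : ι => E => u i) hCw
  have hcard (i : ι) : (Fintype.card ι : ℝ) ≠ 0 :=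
    Nat.cast_ne_zero.2 (Fintype.card_pos_iff.2 ⟨i⟩).ne'
  have hsum : sumOp ι E w = 0 := by
    ext i
    have h := Finset.sum_eq_zero fun i (_ : i ∈ Finset.univ) => hcomp i
    rw [Finset.sum_add_distrib, sum_lapOp_apply hT, zero_add, Finset.sum_const, Finset.card_univ,
      ← Nat.cast_smul_eq_nsmul ℝ] at h
    simpa using (smul_eq_zero.1 h).resolve_left (hcard i)
  have hlap : lapOp T w = 0 := by simpa [hsum] using hCw
  have hconst := hsync μ w (fun i => congrArg (fun u : PiLp 2 fun _ : ι => E => u i) hPw) hlap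
  ext i
  have h : ∑ j, w j = 0 := by simpa using congrArg (fun u : PiLp 2 fun _ : ι => E => u i) hsum
  simp only [hconst _ i, Finset.sum_const, Finset.card_univ, ← Nat.cast_smul_eq_nsmul ℝ] at h
  exact (smul_eq_zero.1 h).resolve_left (hcard i)

theorem eventually_forall_tendsto_sub_zero [FiniteDimensional ℝ E] {P : E →L[ℝ] E}
    {S T : ι → ι → E →L[ℝ] E} (hP : P.IsSymmetric) (hPpos : ∀ x, x ≠ 0 → 0 < ⟪P x, x⟫_ℝ)
    (hS : ∀ i j, S i j = S j i) (hSsymm : ∀ i j, (S i j).IsSymmetric)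
    (hT : ∀ i j, T i j = T j i) (hTpos : ∀ i j, (T i j).IsPositive)
    (hobs : IsObservable (diagOp ι P) (lapOp T + sumOp ι E)) :
    ∀ᶠ ε : ℝ in 𝓝 0, ∀ z : ℝ → PiLp 2 fun _ : ι => E,
      IsDampedSolution (diagOp ι P + lapOp fun i j => ε • S i j) (lapOp T) z →
        ∀ i j, Tendsto (fun t => z t i - z t j) atTop (𝓝 0) := by
  have hcont : Tendsto (fun ε : ℝ => diagOp ι P + lapOp fun i j => ε • S i j) (𝓝 0)
      (𝓝 (diagOp ι P)) := by
    simp only [lapOp_smul]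
    exact Continuous.tendsto' (by fun_prop) _ _ (by rw [zero_smul ℝ (lapOp S), add_zero])
  filter_upwards [hcont ((isOpen_setOf_isObservable _).mem_nhds hobs),
    hcont (isOpen_setOf_forall_inner_self_pos.mem_nhds fun w hw => inner_diagOp_self_pos hPpos hw)]
    with ε hobsε hposε z hz i j
  have hSε (i j : ι) : ε • S i j = ε • S j i := by rw [hS]
  have hA : (diagOp ι P + lapOp fun i j => ε • S i j).IsSymmetric :=
    (isSymmetric_diagOp hP).add (isSymmetric_lapOp hSε fun i j => (hSsymm i j).smul (by simp))
  have hC : (lapOp T + sumOp ι E).IsPositive := (isPositive_lapOp hT hTpos).add isPositive_sumOp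
  have hlim := (hz.centering hSε hT).tendsto_zero hA hposε hC hobsε
  have hcomp (i : ι) : Tendsto (fun t => centeringOp ι E (z t) i) atTop (𝓝 0) :=
    ((PiLp.proj (𝕜 := ℝ) 2 (fun _ : ι => E) i).continuous.tendsto 0).comp hlim
  simpa only [centeringOp_apply, sub_sub_sub_cancel_right, sub_zero] using (hcomp i).sub (hcomp j)

end Array

section Projection

variable {q n : ℕ} {W : Fin q → Fin q → Matrix (Fin n) (Fin n) ℝ}

theorem idKron_mulVec (v : Fin n → ℝ) (u : Fin q → ℝ) :
    idKron q v *ᵥ u = fun x => (u x.1 • v) x.2 := by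
  ext x
  simp [idKron, Matrix.mulVec, dotProduct, Matrix.one_apply, mul_comm]

theorem lap_mulVec (hW : ∀ i, W i i = 0) (w : Fin q → Fin n → ℝ) :
    (lap W *ᵥ fun y => w y.1 y.2) = fun x => (∑ j, W x.1 j *ᵥ (w x.1 - w j)) x.2 := by
  ext ⟨i, a⟩
  have hblock (j : Fin q) : ∑ b, lap W (i, a) (j, b) * w j b =
      (if i = j then ((∑ l, W i l) *ᵥ w i) a else 0) - (W i j *ᵥ w j) a := by
    by_cases hij : i = j
    · subst hij
      simp [lap, hW, Matrix.mulVec, dotProduct]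
    · simp [lap, hij, Matrix.mulVec, dotProduct]
  calc (lap W *ᵥ fun y => w y.1 y.2) (i, a) = ∑ j, ∑ b, lap W (i, a) (j, b) * w j b := by
        simp only [Matrix.mulVec, dotProduct, Fintype.sum_prod_type]
    _ = ((∑ l, W i l) *ᵥ w i) a - ∑ j, (W i j *ᵥ w j) a := by
        simp only [hblock, Finset.sum_sub_distrib, Finset.sum_ite_eq, Finset.mem_univ, if_true]
    _ = (∑ j, W i j *ᵥ (w i - w j)) a := by
        simp only [Matrix.mulVec_sub, Matrix.sum_mulVec, Finset.sum_apply, Pi.sub_apply,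
          Finset.sum_sub_distrib]

theorem projLap_lap_mulVec_eq_zero (hW : ∀ i, W i i = 0) {v : EuclideanSpace ℝ (Fin n)}
    {u : Fin q → ℝ}
    (hu : lapOp (fun i j => toEuclideanCLM (𝕜 := ℝ) (W i j)) (WithLp.toLp 2 fun i => u i • v) = 0) :
    projLap (lap W) v.ofLp *ᵥ u = 0 := by
  have hlap : lap W *ᵥ (idKron q v.ofLp *ᵥ u) = 0 := by
    rw [idKron_mulVec, lap_mulVec hW fun i => u i • v.ofLp]
    ext ⟨i, a⟩
    have h := congrArg (fun w : PiLp 2 fun _ : Fin q => EuclideanSpace ℝ (Fin n) => (w i).ofLp a) hu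
    simpa only [lapOp_apply, WithLp.ofLp_sum, Matrix.ofLp_toEuclideanCLM, WithLp.ofLp_sub,
      WithLp.ofLp_smul, PiLp.zero_apply, WithLp.ofLp_zero, Pi.zero_apply] using h
  rw [projLap, ← Matrix.mulVec_mulVec, ← Matrix.mulVec_mulVec, hlap, Matrix.mulVec_zero]

theorem eq_of_lapOp_eq_zero_of_eigRe_one_pos (hq : 1 < q) (hW : ∀ i, W i i = 0)
    {v : EuclideanSpace ℝ (Fin n)}
    (hG : 0 < eigRe ((projLap (lap W) v.ofLp).map Complex.ofReal) ⟨1, hq⟩)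
    {w : PiLp 2 fun _ : Fin q => EuclideanSpace ℝ (Fin n)}
    (hw : lapOp (fun i j => toEuclideanCLM (𝕜 := ℝ) (W i j)) w = 0)
    (hspan : ∀ i, w i ∈ Submodule.span ℝ {v}) (i j : Fin q) : w i = w j := by
  choose u hu using fun i => Submodule.mem_span_singleton.1 (hspan i)
  have hw' : w = WithLp.toLp 2 fun i => u i • v := PiLp.ext fun i => (hu i).symm
  have hone : projLap (lap W) v.ofLp *ᵥ 1 = 0 := projLap_lap_mulVec_eq_zero hW <| by
    ext i : 1
    simp
  have huu := eq_of_mulVec_eq_zero_of_eigRe_one_pos hq hG hone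
    (projLap_lap_mulVec_eq_zero hW (hw' ▸ hw)) i j
  rw [← hu i, ← hu j, huu]

theorem isObservable_diagOp_of_forall_eigRe_one_pos (hq : 1 < q)
    {P : EuclideanSpace ℝ (Fin n) →L[ℝ] EuclideanSpace ℝ (Fin n)} {σ : Fin n → ℝ}
    (hσ : Function.Injective σ) {v : Fin n → EuclideanSpace ℝ (Fin n)}
    (hv : ∀ k, Module.End.HasEigenvector P.toLinearMap (σ k) (v k)) (hW : ∀ i, W i i = 0)
    (hWsymm : ∀ i j, W i j = W j i)
    (hG : ∀ k, 0 < eigRe ((projLap (lap W) (v k).ofLp).map Complex.ofReal) ⟨1, hq⟩) :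
    IsObservable (diagOp (Fin q) P)
      (lapOp (fun i j => toEuclideanCLM (𝕜 := ℝ) (W i j)) + sumOp (Fin q) _) := by
  refine isObservable_diagOp (fun i j => by rw [hWsymm]) fun μ w hPw hw i j => ?_
  have hmem (i : Fin q) : w i ∈ Module.End.eigenspace P.toLinearMap μ :=
    Module.End.mem_eigenspace_iff.2 (hPw i)
  by_cases hμ : Module.End.HasEigenvalue P.toLinearMap μ
  · obtain ⟨k, hk⟩ := exists_eigenspace_le_span_singleton hσ hv (by simp) hμ
    exact eq_of_lapOp_eq_zero_of_eigRe_one_pos hq hW (hG k) hw (fun i => hk (hmem i)) i j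
  · have hzero (i : Fin q) : w i = 0 := by
      simpa [not_not.1 hμ] using hmem i
    rw [hzero, hzero]

end Projection

section EuclideanOperator

variable {n : ℕ} {N : Matrix (Fin n) (Fin n) ℝ}

theorem isSymmetric_toEuclideanCLM (hN : N.IsHermitian) :
    (toEuclideanCLM (𝕜 := ℝ) N).IsSymmetric :=
  Matrix.isSymmetric_toEuclideanLin_iff.2 hN

theorem isPositive_toEuclideanCLM (hN : N.PosSemidef) :
    (toEuclideanCLM (𝕜 := ℝ) N).IsPositive :=
  (ContinuousLinearMap.isPositive_toLinearMap_iff _).1 (Matrix.isPositive_toEuclideanLin_iff.2 hN)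

theorem inner_toEuclideanCLM_self_pos (hN : N.PosDef) {y : EuclideanSpace ℝ (Fin n)}
    (hy : y ≠ 0) : 0 < ⟪toEuclideanCLM (𝕜 := ℝ) N y, y⟫_ℝ := by
  rw [real_inner_comm, EuclideanSpace.inner_eq_star_dotProduct, dotProduct_comm,
    Matrix.ofLp_toEuclideanCLM]
  exact hN.dotProduct_mulVec_pos ((WithLp.ofLp_eq_zero 2).ne.2 hy)

end EuclideanOperator

section Normalization

variable {n : ℕ} {M : Matrix (Fin n) (Fin n) ℝ}

theorem isHermitian_invSqrt (M : Matrix (Fin n) (Fin n) ℝ) : (invSqrt M).IsHermitian :=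
  (Matrix.nonneg_iff_posSemidef.1 (CFC.sqrt_nonneg M)).isHermitian.inv

theorem isHermitian_normalized {N : Matrix (Fin n) (Fin n) ℝ} (hN : N.IsHermitian)
    (M : Matrix (Fin n) (Fin n) ℝ) : (normalized M N).IsHermitian := by
  have h := Matrix.isHermitian_conjTranspose_mul_mul (invSqrt M) hN
  rwa [(isHermitian_invSqrt M).eq] at h

theorem posSemidef_normalized {N : Matrix (Fin n) (Fin n) ℝ} (hN : N.PosSemidef)
    (M : Matrix (Fin n) (Fin n) ℝ) : (normalized M N).PosSemidef := by
  have h := hN.conjTranspose_mul_mul_same (invSqrt M)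
  rwa [(isHermitian_invSqrt M).eq] at h

theorem normalized_smul (M N : Matrix (Fin n) (Fin n) ℝ) (c : ℝ) :
    normalized M (c • N) = c • normalized M N := by
  simp [normalized]

theorem sqrt_mul_sqrt_self_of_posDef (hM : M.PosDef) : CFC.sqrt M * CFC.sqrt M = M :=
  CFC.sqrt_mul_sqrt_self M (Matrix.nonneg_iff_posSemidef.2 hM.posSemidef)

theorem isUnit_sqrt_of_posDef (hM : M.PosDef) : IsUnit (CFC.sqrt M) :=
  isUnit_of_mul_isUnit_left ((sqrt_mul_sqrt_self_of_posDef hM).symm ▸ hM.isUnit)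

theorem invSqrt_mul_sqrt (hM : M.PosDef) : invSqrt M * CFC.sqrt M = 1 :=
  Matrix.nonsing_inv_mul _ ((Matrix.isUnit_iff_isUnit_det _).1 (isUnit_sqrt_of_posDef hM))

theorem normalized_self (hM : M.PosDef) : normalized M M = 1 := by
  calc normalized M M = invSqrt M * (CFC.sqrt M * CFC.sqrt M) * invSqrt M := by
        rw [sqrt_mul_sqrt_self_of_posDef hM, normalized]
    _ = CFC.sqrt M * invSqrt M := by rw [← mul_assoc, invSqrt_mul_sqrt hM, one_mul]
    _ = 1 := mul_eq_one_comm.1 (invSqrt_mul_sqrt hM)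

theorem normalized_mul_sqrt (hM : M.PosDef) (N : Matrix (Fin n) (Fin n) ℝ) :
    normalized M N * CFC.sqrt M = invSqrt M * N := by
  rw [normalized, mul_assoc, invSqrt_mul_sqrt hM, mul_one]

theorem posDef_normalized {K : Matrix (Fin n) (Fin n) ℝ} (hM : M.PosDef) (hK : K.PosDef) :
    (normalized M K).PosDef := by
  have hinj : Function.Injective (invSqrt M).mulVec :=
    Matrix.mulVec_injective_of_isUnit (Matrix.isUnit_nonsing_inv_iff.2 (isUnit_sqrt_of_posDef hM))
  have h := hK.conjTranspose_mul_mul_same hinj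
  rwa [(isHermitian_invSqrt M).eq] at h

theorem IsArraySolution.isDampedSolution {q : ℕ} {K : Matrix (Fin n) (Fin n) ℝ}
    {D R : Fin q → Fin q → Matrix (Fin n) (Fin n) ℝ}
    {x : Fin q → ℝ → EuclideanSpace ℝ (Fin n)} (hM : M.PosDef) (hx : IsArraySolution M K D R x) :
    IsDampedSolution
      (diagOp (Fin q) (toEuclideanCLM (𝕜 := ℝ) (normalized M K)) +
        lapOp fun i j => toEuclideanCLM (𝕜 := ℝ) (normalized M (R i j)))
      (lapOp fun i j => toEuclideanCLM (𝕜 := ℝ) (normalized M (D i j)))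
      fun t => diagOp (Fin q) (toEuclideanCLM (𝕜 := ℝ) (CFC.sqrt M)) (WithLp.toLp 2 (x · t)) := by
  obtain ⟨x', x'', hx', hx'', heq⟩ := hx
  have hmul (N : Matrix (Fin n) (Fin n) ℝ) (y : EuclideanSpace ℝ (Fin n)) :
      toEuclideanCLM (𝕜 := ℝ) (normalized M N) (toEuclideanCLM (𝕜 := ℝ) (CFC.sqrt M) y) =
        toEuclideanCLM (𝕜 := ℝ) (invSqrt M) (toEuclideanCLM (𝕜 := ℝ) N y) := by
    rw [← mul_apply_eq_comp, ← map_mul, normalized_mul_sqrt hM, map_mul, mul_apply_eq_comp]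
  refine ⟨_, _, hasDerivAt_diagOp_toLp _ hx', hasDerivAt_diagOp_toLp _ hx'', fun t => ?_⟩
  have hforce (i : Fin q) : toEuclideanCLM (𝕜 := ℝ) M (x'' i t) +
      ∑ j, toEuclideanCLM (𝕜 := ℝ) (D i j) (x' i t - x' j t) +
      (toEuclideanCLM (𝕜 := ℝ) K (x i t) +
        ∑ j, toEuclideanCLM (𝕜 := ℝ) (R i j) (x i t - x j t)) = 0 := by
    refine WithLp.ofLp_injective 2 (Eq.trans ?_ (heq i t))
    simp only [WithLp.ofLp_add, WithLp.ofLp_sum, Matrix.ofLp_toEuclideanCLM]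
    abel
  ext i : 1
  have h := congrArg (toEuclideanCLM (𝕜 := ℝ) (invSqrt M)) (hforce i)
  simp only [map_add, map_sum, map_zero, ← hmul, normalized_self hM, map_one,
    one_apply_eq_self, map_sub] at h
  simpa only [PiLp.add_apply, add_apply, diagOp_apply, lapOp_apply, map_sub, PiLp.zero_apply]
    using h

end Normalization

theorem mainTheorem6_general (q n : ℕ) (hq : 2 ≤ q)
    (M K : Matrix (Fin n) (Fin n) ℝ) (hM : M.PosDef) (hK : K.PosDef)
    (D R : Fin q → Fin q → Matrix (Fin n) (Fin n) ℝ) (hD : IsWeight D)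
    (hR : ∀ i j, (R i j).IsHermitian) (hRsymm : ∀ i j, R i j = R j i)
    (σ : Fin n → ℝ) (hσ : Function.Injective σ)
    (v : Fin n → EuclideanSpace ℝ (Fin n)) (hv : ∀ k, v k ≠ 0)
    (hPv : ∀ k, normalized M K *ᵥ (v k).ofLp = σ k • (v k).ofLp)
    (hG : ∀ k, 0 < eigRe ((projLap (dissLap M D) (v k).ofLp).map Complex.ofReal) ⟨1, hq⟩) :
    ∀ᶠ ε : ℝ in 𝓝 0, Synchronizes M K D fun i j => ε • R i j := by
  have hobs := isObservable_diagOp_of_forall_eigRe_one_pos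
    (W := fun i j => normalized M (D i j)) (P := toEuclideanCLM (𝕜 := ℝ) (normalized M K)) hq hσ
    (fun k => ⟨Module.End.mem_eigenspace_iff.2 (WithLp.ofLp_injective 2 (hPv k)), hv k⟩)
    (fun i => by simp [normalized, hD.diag]) (fun i j => by rw [hD.symm]) hG
  have hP := posDef_normalized hM hK
  filter_upwards [eventually_forall_tendsto_sub_zero
    (S := fun i j => toEuclideanCLM (𝕜 := ℝ) (normalized M (R i j)))
    (isSymmetric_toEuclideanCLM hP.isHermitian) (fun y => inner_toEuclideanCLM_self_pos hP)
    (fun i j => by rw [hRsymm])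
    (fun i j => isSymmetric_toEuclideanCLM (isHermitian_normalized (hR i j) M))
    (fun i j => by rw [hD.symm])
    (fun i j => isPositive_toEuclideanCLM (posSemidef_normalized (hD.posSemidef i j) M)) hobs]
    with ε hε x hx i j
  have hlim := hε _ (by simpa only [normalized_smul, map_smul] using hx.isDampedSolution hM) i j
  have h := ((toEuclideanCLM (𝕜 := ℝ) (invSqrt M)).continuous.tendsto' 0 0 (map_zero _)).comp hlim
  refine (tendsto_zero_iff_norm_tendsto_zero.1 h).congr fun t => ?_
  simp only [Function.comp_apply, diagOp_apply, ← map_sub, ← mul_apply_eq_comp, ← map_mul,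
    invSqrt_mul_sqrt hM, map_one, one_apply_eq_self]

theorem mainTheorem6 (q n : ℕ) (hq : 2 ≤ q)
    (M K : Matrix (Fin n) (Fin n) ℝ) (hM : M.PosDef) (hK : K.PosDef)
    (D R : Fin q → Fin q → Matrix (Fin n) (Fin n) ℝ) (hD : IsWeight D) (hR : IsWeight R)
    (σ : Fin n → ℝ) (hσ : Function.Injective σ)
    (v : Fin n → EuclideanSpace ℝ (Fin n)) (hv : ∀ k, ‖v k‖ = 1)
    (hPv : ∀ k, normalized M K *ᵥ (v k).ofLp = σ k • (v k).ofLp)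
    (hG : ∀ k, 0 < eigRe ((projLap (dissLap M D) (v k).ofLp).map Complex.ofReal) ⟨1, hq⟩) :
    ∃ r : ℝ, 0 < r ∧ ∀ ε : ℝ, 0 < ε → ε < r →
      Synchronizes M K D (fun i j => ε • R i j) := by
  have hv0 (k : Fin n) : v k ≠ 0 := norm_ne_zero_iff.1 (by rw [hv]; exact one_ne_zero)
  obtain ⟨r, hr, hsync⟩ := Metric.eventually_nhds_iff.1 <| mainTheorem6_general q n hq M K hM hK D R
    hD (fun i j => (hR.posSemidef i j).isHermitian) hR.symm σ hσ v hv0 hPv hG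
  exact ⟨r, hr, fun ε hε hεr => hsync (by rwa [Real.dist_0_eq_abs, abs_of_pos hε])⟩
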